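/- Let $\mathcal X$ be a separable real Banach space that is $(2,D)$-smooth, that is, $D>0$ and $\|x+y\|^2+\|x-y\|^2\le 2\|x\|^2+2D^2\|y\|^2$ for all $x,y\in\mathcal X$. Let $f=(f_j)_{j\ge 0}$ be an $\mathcal X$-valued martingale (with Bochner-integrable $f_j$) on a probability space $(\Omega,F,\mathbf P)$ relative to a filtration $(F_j)_{j\ge 0}$, with $f_0\equiv 0$, and suppose that for each $j\ge 1$ the increment $d_j=f_j-f_{j-1}$ is $F_{j-1}$-conditionally symmetrically distributed: $\mathbf P(d_j\in B\mid F_{j-1})=\mathbf P(-d_j\in B\mid F_{j-1})$ almost surely for every Borel set $B\subseteq\mathcal X$. Put $f^*=\sup_{j\ge 0}\|f_j\|$ and $S_2=\bigl(\sum_{j\ge 1}\|d_j\|^2\bigr)^{1/2}$, and let $\|Z\|_p=(\mathbf E Z^p)^{1/p}\in[0,\infty]$ for a random variable $Z$ with values in $[0,\infty]$. Then, for an absolute constant $A>0$, $$\|f^*\|_p\le A\sqrt p\,D\,\|S_2\|_p\qquad\text{for all real } p\ge 1 .$$ This bound is optimal up to an absolute constant factor, already for $\mathcal X=\mathbf R$,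 which is $(2,1)$-smooth: there is an absolute constant $c>0$ such that for all real $p\ge 1$ and $a>0$ there is a real-valued martingale $f$ as above (with $F_{j-1}$-conditionally symmetrically distributed increments and $f_0\equiv0$) such that $\|S_2\|_p=a$ and $\|f^*\|_p\ge c\sqrt p\,a$. -/

import Mathlib

open MeasureTheory ProbabilityTheory
open scoped ENNReal

/-- The real normed space `X` is `(2, D)`-smooth, where `D > 0`:
`‖x + y‖² + ‖x - y‖² ≤ 2 ‖x‖² + 2 D² ‖y‖²` for all `x` and `y`. -/
def IsTwoSmooth (X : Type*) [NormedAddCommGroup X] (D : ℝ) : Prop :=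
  0 < D ∧ ∀ x y : X, ‖x + y‖ ^ 2 + ‖x - y‖ ^ 2 ≤ 2 * ‖x‖ ^ 2 + 2 * D ^ 2 * ‖y‖ ^ 2

/-- The increments of a sequence `f₀, f₁, …`, indexed from zero:
`increment f j = f (j + 1) - f j` is the increment usually written `d_{j+1}`. -/
def increment {Ω X : Type*} [NormedAddCommGroup X] (f : ℕ → Ω → X) (j : ℕ) (ω : Ω) : X :=
  f (j + 1) ω - f j ω

/-- The maximal function `f* = sup_j ‖f_j‖`, with values in `[0, ∞]`. -/
noncomputable def maximalFunction {Ω X : Type*} [NormedAddCommGroup X]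
    (f : ℕ → Ω → X) (ω : Ω) : ℝ≥0∞ :=
  ⨆ j, ‖f j ω‖ₑ

/-- The square function `S₂ = (∑_{j ≥ 1} ‖d_j‖²)^{1/2}`, with values in `[0, ∞]`. -/
noncomputable def squareFunction {Ω X : Type*} [NormedAddCommGroup X]
    (f : ℕ → Ω → X) (ω : Ω) : ℝ≥0∞ :=
  (∑' j, ‖increment f j ω‖ₑ ^ 2) ^ (1 / 2 : ℝ)

/-- The random vector `d` is `m`-conditionally symmetrically distributed: given `m`, the vectors
`d` and `-d` have the same conditional distribution, that is, for every Borel set `B` one has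
`P(d ∈ B | m) = P(-d ∈ B | m)` almost surely. -/
def IsCondSymmetric {Ω X : Type*} [NormedAddCommGroup X] [MeasurableSpace X]
    (m : MeasurableSpace Ω) {mΩ : MeasurableSpace Ω} (μ : Measure Ω) (d : Ω → X) : Prop :=
  ∀ B : Set X, MeasurableSet B →
    μ⟦{ω | d ω ∈ B} | m⟧ =ᵐ[μ] μ⟦{ω | -d ω ∈ B} | m⟧

/-- `f` is a martingale with respect to the filtration `ℱ` that starts from `f₀ ≡ 0`, and each of
its increments `d_j = f_j - f_{j-1}`, `j ≥ 1`, is `ℱ_{j-1}`-conditionally symmetrically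
distributed. -/
structure IsCondSymmetricMartingale {Ω X : Type*} [NormedAddCommGroup X] [NormedSpace ℝ X]
    [CompleteSpace X] [MeasurableSpace X] {mΩ : MeasurableSpace Ω}
    (f : ℕ → Ω → X) (ℱ : Filtration ℕ mΩ) (μ : Measure Ω) : Prop where
  martingale : Martingale f ℱ μ
  zero : ∀ ω, f 0 ω = 0
  condSymmetric : ∀ j, IsCondSymmetric (ℱ j) μ (increment f j)

/-- Weak majorization of `(U, V)` by `(M, m)` passes to powers. -/
theorem pow_add_pow_le_of_majorized {U V M m : ℝ} (hU : 0 ≤ U) (hV : 0 ≤ V) (hm : 0 ≤ m)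
    (hUM : U ≤ M) (hVM : V ≤ M) (h : U + V ≤ M + m) (n : ℕ) :
    U ^ n + V ^ n ≤ M ^ n + m ^ n := by
  rcases le_total V m with hVm | hmV
  · exact add_le_add (pow_le_pow_left₀ hU hUM n) (pow_le_pow_left₀ hV hVm n)
  rcases eq_or_lt_of_le (hmV.trans hVM) with hmM | hmM
  · exact add_le_add (pow_le_pow_left₀ hU hUM n)
      (pow_le_pow_left₀ hV (hVM.trans hmM.ge) n)
  have hpos : 0 < M - m := sub_pos.2 hmM
  set α := (V - m) / (M - m) with hα
  have hα0 : 0 ≤ α := div_nonneg (sub_nonneg.2 hmV) hpos.le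
  have hα1 : α ≤ 1 := (div_le_one hpos).2 (by linarith)
  have hαmul : α * (M - m) = V - m := div_mul_cancel₀ _ hpos.ne'
  have hM0 : 0 ≤ M := hU.trans hUM
  have key (β : ℝ) (h0 : 0 ≤ β) (h1 : β ≤ 1) :
      (β * M + (1 - β) * m) ^ n ≤ β * M ^ n + (1 - β) * m ^ n := by
    simpa using (convexOn_pow n).2 (Set.mem_Ici.2 hM0) (Set.mem_Ici.2 hm) h0
      (sub_nonneg.2 h1) (by ring)
  have h1 := key α hα0 hα1
  have h2 := key (1 - α) (by linarith) (by linarith)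
  have e1 : α * M + (1 - α) * m = V := by linear_combination hαmul
  have e2 : (1 - α) * M + (1 - (1 - α)) * m = M + m - V := by linear_combination -hαmul
  rw [e1] at h1
  rw [e2] at h2
  have h3 : U ^ n ≤ (M + m - V) ^ n := pow_le_pow_left₀ hU (by linarith) n
  linarith

theorem cosh_add_cosh_le_of_majorized {u v a b : ℝ}
    (hu : u ^ 2 ≤ (a + b) ^ 2) (hv : v ^ 2 ≤ (a + b) ^ 2)
    (h : u ^ 2 + v ^ 2 ≤ (a + b) ^ 2 + (a - b) ^ 2) :
    Real.cosh u + Real.cosh v ≤ 2 * (Real.cosh a * Real.cosh b) := by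
  have e : 2 * (Real.cosh a * Real.cosh b) = Real.cosh (a + b) + Real.cosh (a - b) := by
    rw [Real.cosh_add, Real.cosh_sub]; ring
  rw [e]
  refine hasSum_le (fun n ↦ ?_) ((Real.hasSum_cosh u).add (Real.hasSum_cosh v))
    ((Real.hasSum_cosh (a + b)).add (Real.hasSum_cosh (a - b)))
  rw [← add_div, ← add_div]
  refine div_le_div_of_nonneg_right ?_ (Nat.cast_nonneg _)
  rw [pow_mul, pow_mul, pow_mul, pow_mul]
  exact pow_add_pow_le_of_majorized (sq_nonneg u) (sq_nonneg v) (sq_nonneg _) hu hv h n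

section TwoSmooth

variable {X : Type*} [NormedAddCommGroup X] {D : ℝ}

theorem IsTwoSmooth.norm_le (h : IsTwoSmooth X D) (y : X) : ‖y‖ ≤ D * ‖y‖ := by
  have h1 := h.2 0 y
  simp only [zero_add, zero_sub, norm_neg, norm_zero] at h1
  have h2 : ‖y‖ ^ 2 ≤ (D * ‖y‖) ^ 2 := by nlinarith
  exact (abs_le_of_sq_le_sq' h2 (mul_nonneg h.1.le (norm_nonneg y))).2

theorem IsTwoSmooth.one_le [Nontrivial X] (h : IsTwoSmooth X D) : 1 ≤ D := by
  obtain ⟨y, hy⟩ := exists_ne (0 : X)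
  have h1 := h.norm_le y
  have h2 := norm_pos_iff.2 hy
  by_contra hD
  nlinarith

theorem isTwoSmooth_real : IsTwoSmooth ℝ 1 := by
  refine ⟨one_pos, fun x y ↦ le_of_eq ?_⟩
  simp only [Real.norm_eq_abs, sq_abs]
  ring

theorem IsTwoSmooth.cosh_norm_add_cosh_norm_le (h : IsTwoSmooth X D) (l : ℝ) (x y : X) :
    Real.cosh (l * ‖x + y‖) + Real.cosh (l * ‖x - y‖) ≤
      2 * (Real.cosh (l * ‖x‖) * Real.cosh (l * (D * ‖y‖))) := by
  have hy := h.norm_le y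
  have h1 : ‖x + y‖ ^ 2 ≤ (‖x‖ + D * ‖y‖) ^ 2 := by
    have := norm_add_le x y
    gcongr; linarith
  have h2 : ‖x - y‖ ^ 2 ≤ (‖x‖ + D * ‖y‖) ^ 2 := by
    have := norm_sub_le x y
    gcongr; linarith
  have h3 := h.2 x y
  have hl := sq_nonneg l
  refine cosh_add_cosh_le_of_majorized ?_ ?_ ?_
  · nlinarith [mul_le_mul_of_nonneg_left h1 hl]
  · nlinarith [mul_le_mul_of_nonneg_left h2 hl]
  · nlinarith [mul_le_mul_of_nonneg_left h3 hl]

theorem IsTwoSmooth.cosh_norm_add_cosh_norm_mul_exp_le (h : IsTwoSmooth X D) (l q : ℝ) (x y : X) :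
    Real.cosh (l * ‖x + y‖) * Real.exp (-(l ^ 2 * D ^ 2 / 2) * (q + ‖y‖ ^ 2)) +
      Real.cosh (l * ‖x - y‖) * Real.exp (-(l ^ 2 * D ^ 2 / 2) * (q + ‖y‖ ^ 2)) ≤
    2 * (Real.cosh (l * ‖x‖) * Real.exp (-(l ^ 2 * D ^ 2 / 2) * q)) := by
  have h1 := h.cosh_norm_add_cosh_norm_le l x y
  have h2 := Real.cosh_le_exp_half_sq (l * (D * ‖y‖))
  have h3 : Real.exp ((l * (D * ‖y‖)) ^ 2 / 2) *
      Real.exp (-(l ^ 2 * D ^ 2 / 2) * (q + ‖y‖ ^ 2)) = Real.exp (-(l ^ 2 * D ^ 2 / 2) * q) := by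
    rw [← Real.exp_add]; congr 1; ring
  rw [← add_mul, ← h3]
  calc _ ≤ 2 * (Real.cosh (l * ‖x‖) * Real.cosh (l * (D * ‖y‖))) *
        Real.exp (-(l ^ 2 * D ^ 2 / 2) * (q + ‖y‖ ^ 2)) := by gcongr
    _ ≤ 2 * (Real.cosh (l * ‖x‖) * Real.exp ((l * (D * ‖y‖)) ^ 2 / 2)) *
        Real.exp (-(l ^ 2 * D ^ 2 / 2) * (q + ‖y‖ ^ 2)) := by
      gcongr
    _ = _ := by ring

end TwoSmooth

section Symmetry

variable {Ω X β : Type*} [NormedAddCommGroup X] [MeasurableSpace X] [BorelSpace X]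
  [MeasurableSpace β] {m mΩ : MeasurableSpace Ω} {μ : Measure Ω}
  [IsProbabilityMeasure μ] {d : Ω → X} {w : Ω → β}

theorem IsCondSymmetric.measure_inter_eq (h : IsCondSymmetric m μ d) (hm : m ≤ mΩ)
    (hd : Measurable d) {F : Set Ω} (hF : MeasurableSet[m] F) {B : Set X} (hB : MeasurableSet B) :
    μ (F ∩ {ω | d ω ∈ B}) = μ (F ∩ {ω | -d ω ∈ B}) := by
  have key (e : Ω → X) (he : Measurable e) :
      ∫ ω in F, (μ⟦{ω | e ω ∈ B} | m⟧) ω ∂μ = μ.real (F ∩ {ω | e ω ∈ B}) := by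
    have hs : MeasurableSet {ω | e ω ∈ B} := he hB
    rw [setIntegral_condExp hm ((integrable_const (1 : ℝ)).indicator hs) hF,
      setIntegral_indicator hs]
    simp
  have h1 := setIntegral_congr_ae (μ := μ) (hm F hF)
    ((h B hB).mono fun ω hω _ ↦ hω)
  rw [key d hd, key (fun ω ↦ -d ω) hd.neg] at h1
  exact (measureReal_eq_measureReal_iff).1 h1

theorem IsCondSymmetric.map_prodMk_eq (h : IsCondSymmetric m μ d) (hm : m ≤ mΩ)
    (hd : Measurable d) (hw : Measurable[m] w) :
    μ.map (fun ω ↦ (w ω, d ω)) = μ.map (fun ω ↦ (w ω, -d ω)) := by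
  have hw' : Measurable w := hw.mono hm le_rfl
  have h1 : Measurable fun ω ↦ (w ω, d ω) := hw'.prodMk hd
  have h2 : Measurable fun ω ↦ (w ω, -d ω) := hw'.prodMk hd.neg
  have := Measure.isProbabilityMeasure_map (μ := μ) h1.aemeasurable
  refine Measure.ext_prod fun {s t} hs ht ↦ ?_
  rw [Measure.map_apply h1 (hs.prod ht), Measure.map_apply h2 (hs.prod ht)]
  exact h.measure_inter_eq hm hd (hw hs) ht

theorem IsCondSymmetric.lintegral_le_of_add_neg_le (h : IsCondSymmetric m μ d) (hm : m ≤ mΩ)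
    (hd : Measurable d) (hw : Measurable[m] w) {Φ : β × X → ℝ} (hΦ : Measurable Φ)
    (hΦ0 : ∀ z, 0 ≤ Φ z) {Ψ : β → ℝ} (hle : ∀ b x, Φ (b, x) + Φ (b, -x) ≤ 2 * Ψ b) :
    ∫⁻ ω, ENNReal.ofReal (Φ (w ω, d ω)) ∂μ ≤ ∫⁻ ω, ENNReal.ofReal (Ψ (w ω)) ∂μ := by
  have hw' : Measurable w := hw.mono hm le_rfl
  have h1 : Measurable fun ω ↦ (w ω, d ω) := hw'.prodMk hd
  have h2 : Measurable fun ω ↦ (w ω, -d ω) := hw'.prodMk hd.neg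
  have hsymm : ∫⁻ ω, ENNReal.ofReal (Φ (w ω, d ω)) ∂μ =
      ∫⁻ ω, ENNReal.ofReal (Φ (w ω, -d ω)) ∂μ := by
    rw [← lintegral_map (f := fun z ↦ ENNReal.ofReal (Φ z)) hΦ.ennreal_ofReal h1,
      h.map_prodMk_eq hm hd hw, lintegral_map hΦ.ennreal_ofReal h2]
  have hsum : 2 * ∫⁻ ω, ENNReal.ofReal (Φ (w ω, d ω)) ∂μ ≤
      2 * ∫⁻ ω, ENNReal.ofReal (Ψ (w ω)) ∂μ := by
    rw [two_mul]
    nth_rewrite 2 [hsymm]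
    rw [← lintegral_add_left (f := fun ω ↦ ENNReal.ofReal (Φ (w ω, d ω)))
      (hΦ.comp h1).ennreal_ofReal,
      ← lintegral_const_mul' _ _ ENNReal.ofNat_ne_top]
    refine lintegral_mono fun ω ↦ ?_
    rw [← ENNReal.ofReal_add (hΦ0 _) (hΦ0 _), ← ENNReal.ofReal_ofNat 2,
      ← ENNReal.ofReal_mul zero_le_two]
    exact ENNReal.ofReal_le_ofReal (hle _ _)
  exact (ENNReal.mul_le_mul_iff_right two_ne_zero ENNReal.ofNat_ne_top).1 hsum

end Symmetry

section Transform

/-- The transform `∑_{j < n} a_j d_{j+1}` of `f` by the sequence `a`. -/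
noncomputable def martingaleTransform {Ω X : Type*} [NormedAddCommGroup X] [NormedSpace ℝ X]
    (a : ℕ → Ω → ℝ) (f : ℕ → Ω → X) (n : ℕ) (ω : Ω) : X :=
  ∑ j ∈ Finset.range n, a j ω • increment f j ω

/-- The squared square function of the transform of `f` by the sequence `a`. -/
noncomputable def transformBracket {Ω X : Type*} [NormedAddCommGroup X] [NormedSpace ℝ X]
    (a : ℕ → Ω → ℝ) (f : ℕ → Ω → X) (n : ℕ) (ω : Ω) : ℝ :=
  ∑ j ∈ Finset.range n, ‖a j ω • increment f j ω‖ ^ 2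

variable {Ω X : Type*} [NormedAddCommGroup X] [NormedSpace ℝ X] [CompleteSpace X]
  [MeasurableSpace X] [BorelSpace X] {mΩ : MeasurableSpace Ω}
  {μ : Measure Ω} {ℱ : Filtration ℕ mΩ} {f : ℕ → Ω → X}
  {a : ℕ → Ω → ℝ} {D : ℝ}

theorem IsCondSymmetricMartingale.measurable (h : IsCondSymmetricMartingale f ℱ μ) (j : ℕ) :
    Measurable[ℱ j] (f j) :=
  (h.martingale.1 j).measurable

variable [SecondCountableTopology X]

theorem IsCondSymmetricMartingale.measurable_increment (h : IsCondSymmetricMartingale f ℱ μ)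
    (j : ℕ) : Measurable[ℱ (j + 1)] (increment f j) :=
  (h.measurable (j + 1)).sub ((h.measurable j).mono (ℱ.mono j.le_succ) le_rfl)

theorem IsCondSymmetricMartingale.measurable_smul_increment
    (h : IsCondSymmetricMartingale f ℱ μ) (ha : ∀ j, Measurable[ℱ j] (a j)) {j n : ℕ}
    (hj : j < n) : Measurable[ℱ n] fun ω ↦ a j ω • increment f j ω :=
  ((ha j).mono (ℱ.mono hj.le) le_rfl).smul
    ((h.measurable_increment j).mono (ℱ.mono hj) le_rfl)

theorem IsCondSymmetricMartingale.measurable_transform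
    (h : IsCondSymmetricMartingale f ℱ μ) (ha : ∀ j, Measurable[ℱ j] (a j)) (n : ℕ) :
    Measurable[ℱ n] (martingaleTransform a f n) := by
  unfold martingaleTransform
  exact Finset.measurable_sum _ fun j hj ↦
    h.measurable_smul_increment ha (Finset.mem_range.1 hj)

theorem IsCondSymmetricMartingale.measurable_bracket
    (h : IsCondSymmetricMartingale f ℱ μ) (ha : ∀ j, Measurable[ℱ j] (a j)) (n : ℕ) :
    Measurable[ℱ n] (transformBracket a f n) := by
  unfold transformBracket
  exact Finset.measurable_sum _ fun j hj ↦
    (measurable_norm.pow_const 2).comp (h.measurable_smul_increment ha (Finset.mem_range.1 hj))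

variable [IsProbabilityMeasure μ]

/-- The self-normalized exponential moment bound. -/
theorem IsCondSymmetricMartingale.lintegral_cosh_mul_exp_le_one
    (h : IsCondSymmetricMartingale f ℱ μ) (hD : IsTwoSmooth X D)
    (ha : ∀ j, Measurable[ℱ j] (a j)) (l : ℝ) (n : ℕ) :
    ∫⁻ ω, ENNReal.ofReal (Real.cosh (l * ‖martingaleTransform a f n ω‖) *
      Real.exp (-(l ^ 2 * D ^ 2 / 2) * transformBracket a f n ω)) ∂μ ≤ 1 := by
  induction n with
  | zero => simp [martingaleTransform, transformBracket]
  | succ n ih =>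
    refine le_trans ?_ ih
    have hw : Measurable[ℱ n] fun ω ↦
        (martingaleTransform a f n ω, transformBracket a f n ω, a n ω) :=
      (h.measurable_transform ha n).prodMk ((h.measurable_bracket ha n).prodMk (ha n))
    have hd : Measurable (increment f n) :=
      (h.measurable_increment n).mono (ℱ.le _) le_rfl
    have := (h.condSymmetric n).lintegral_le_of_add_neg_le (ℱ.le n) hd hw
      (Φ := fun z ↦ Real.cosh (l * ‖z.1.1 + z.1.2.2 • z.2‖) *
        Real.exp (-(l ^ 2 * D ^ 2 / 2) * (z.1.2.1 + ‖z.1.2.2 • z.2‖ ^ 2)))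
      (Ψ := fun b ↦ Real.cosh (l * ‖b.1‖) * Real.exp (-(l ^ 2 * D ^ 2 / 2) * b.2.1))
      (by
        have : Measurable Real.cosh := Real.measurable_cosh
        fun_prop)
      (fun z ↦ mul_nonneg (Real.cosh_pos _).le (Real.exp_pos _).le)
      (fun b x ↦ by
        simpa [sub_eq_add_neg] using
          hD.cosh_norm_add_cosh_norm_mul_exp_le l b.2.1 b.1 (b.2.2 • x))
    simpa only [martingaleTransform, transformBracket, Finset.sum_range_succ] using this

end Transform

section Pathwise

variable {X : Type*} [NormedAddCommGroup X] [NormedSpace ℝ X]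

open Classical in
/-- Between the first exceedance of `t` and the first exceedance of `2 t` a sequence with steps at
most `t / 2` travels at least `t / 2`. -/
theorem half_le_norm_sum_of_two_mul_lt_partialSups {x : ℕ → X} (h0 : x 0 = 0) {t : ℝ} (ht : 0 ≤ t)
    {n : ℕ} (hx : ∀ j < n, ‖x (j + 1) - x j‖ ≤ t / 2)
    (hn : 2 * t < partialSups (fun i ↦ ‖x i‖) n) :
    t / 2 ≤ ‖∑ j ∈ Finset.range n,
      (if t < partialSups (fun i ↦ ‖x i‖) j ∧ partialSups (fun i ↦ ‖x i‖) j ≤ 2 * t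
        then (1 : ℝ) else 0) • (x (j + 1) - x j)‖ := by
  set M := partialSups (fun i ↦ ‖x i‖) with hM
  set G : ℕ → X := fun n ↦ ∑ j ∈ Finset.range n,
      (if t < M j ∧ M j ≤ 2 * t then (1 : ℝ) else 0) • (x (j + 1) - x j) with hG
  have hGs (k : ℕ) : G (k + 1) = G k +
      (if t < M k ∧ M k ≤ 2 * t then (1 : ℝ) else 0) • (x (k + 1) - x k) :=
    Finset.sum_range_succ _ _
  have hMs (k : ℕ) : M (k + 1) = max (M k) ‖x (k + 1)‖ := by
    rw [hM, partialSups_add_one]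
  have hxM (k : ℕ) : ‖x k‖ ≤ M k := le_partialSups (fun i ↦ ‖x i‖) k
  have key : ∀ k ≤ n, (M k ≤ t ∧ G k = 0) ∨
      (t < M k ∧ M k ≤ 2 * t ∧ ‖x k - G k‖ ≤ 3 / 2 * t) ∨ (2 * t < M k ∧ t / 2 ≤ ‖G k‖) := by
    intro k
    induction k with
    | zero =>
      intro _
      left
      simp [hM, hG, h0, ht]
    | succ k ih =>
      intro hk
      have hstep := hx k hk
      have htri : ‖x (k + 1)‖ ≤ ‖x k‖ + ‖x (k + 1) - x k‖ := by
        simpa using norm_add_le (x k) (x (k + 1) - x k)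
      rw [hGs, hMs]
      rcases ih (by omega) with ⟨h1, h2⟩ | ⟨h1, h2, h3⟩ | ⟨h1, h2⟩
      · have hx1 : ‖x (k + 1)‖ ≤ 3 / 2 * t := by linarith [hxM k]
        rw [if_neg (fun h ↦ absurd h.1 h1.not_gt), h2, zero_smul, add_zero, sub_zero]
        rcases le_or_gt (max (M k) ‖x (k + 1)‖) t with h | h
        · exact Or.inl ⟨h, rfl⟩
        · exact Or.inr (Or.inl ⟨h, max_le (by linarith) (by linarith), hx1⟩)
      · rw [if_pos ⟨h1, h2⟩, one_smul]
        have e : x (k + 1) - (G k + (x (k + 1) - x k)) = x k - G k := by abel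
        rcases le_or_gt (max (M k) ‖x (k + 1)‖) (2 * t) with h | h
        · exact Or.inr (Or.inl ⟨lt_max_of_lt_left h1, h, by rwa [e]⟩)
        · refine Or.inr (Or.inr ⟨h, ?_⟩)
          have hx1 : 2 * t < ‖x (k + 1)‖ := (lt_max_iff.1 h).resolve_left h2.not_gt
          have := norm_sub_norm_le (x (k + 1)) (G k + (x (k + 1) - x k))
          rw [e] at this
          linarith
      · rw [if_neg (fun h ↦ absurd h.2 h1.not_ge), zero_smul, add_zero]
        exact Or.inr (Or.inr ⟨lt_max_of_lt_left h1, h2⟩)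
  rcases key n le_rfl with ⟨h1, _⟩ | ⟨_, h2, _⟩ | ⟨_, h2⟩
  · linarith
  · linarith
  · exact h2

end Pathwise

/-- The maximal function up to time `n`. -/
noncomputable def runningMax {Ω X : Type*} [NormedAddCommGroup X] (f : ℕ → Ω → X) (n : ℕ)
    (ω : Ω) : ℝ :=
  partialSups (fun i ↦ ‖f i ω‖) n

/-- The square function up to time `n`. -/
noncomputable def partialSquareFunction {Ω X : Type*} [NormedAddCommGroup X] (f : ℕ → Ω → X)
    (n : ℕ) (ω : Ω) : ℝ :=
  √(∑ j ∈ Finset.range n, ‖increment f j ω‖ ^ 2)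

section Elementary

variable {Ω X : Type*} [NormedAddCommGroup X] {f : ℕ → Ω → X}

theorem runningMax_nonneg (f : ℕ → Ω → X) (n : ℕ) (ω : Ω) : 0 ≤ runningMax f n ω :=
  (norm_nonneg (f 0 ω)).trans (le_partialSups_of_le (fun i ↦ ‖f i ω‖) n.zero_le)

theorem monotone_runningMax (f : ℕ → Ω → X) (ω : Ω) : Monotone fun n ↦ runningMax f n ω :=
  (partialSups fun i ↦ ‖f i ω‖).monotone

theorem sq_partialSquareFunction (f : ℕ → Ω → X) (n : ℕ) (ω : Ω) :
    partialSquareFunction f n ω ^ 2 = ∑ j ∈ Finset.range n, ‖increment f j ω‖ ^ 2 :=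
  Real.sq_sqrt (Finset.sum_nonneg fun _ _ ↦ sq_nonneg _)

theorem norm_increment_le_partialSquareFunction (f : ℕ → Ω → X) {j n : ℕ} (hj : j < n) (ω : Ω) :
    ‖increment f j ω‖ ≤ partialSquareFunction f n ω :=
  Real.le_sqrt_of_sq_le <| Finset.single_le_sum (f := fun j ↦ ‖increment f j ω‖ ^ 2)
    (fun _ _ ↦ sq_nonneg _) (Finset.mem_range.2 hj)

theorem runningMax_le_mul_partialSquareFunction {ω : Ω} (h0 : f 0 ω = 0) (n : ℕ) :
    runningMax f n ω ≤ n * partialSquareFunction f n ω := by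
  have hS : 0 ≤ partialSquareFunction f n ω := Real.sqrt_nonneg _
  refine partialSups_le (fun i ↦ ‖f i ω‖) n _ fun i hi ↦ ?_
  have e : f i ω = ∑ j ∈ Finset.range i, increment f j ω := by
    simp [increment, Finset.sum_range_sub (fun j ↦ f j ω), h0]
  rw [e]
  calc _ ≤ ∑ j ∈ Finset.range i, ‖increment f j ω‖ := norm_sum_le _ _
    _ ≤ ∑ j ∈ Finset.range i, partialSquareFunction f n ω :=
      Finset.sum_le_sum fun j hj ↦ norm_increment_le_partialSquareFunction f
        ((Finset.mem_range.1 hj).trans_le hi) ω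
    _ = i * partialSquareFunction f n ω := by simp
    _ ≤ _ := by gcongr

theorem ofReal_runningMax_le (f : ℕ → Ω → X) (n : ℕ) (ω : Ω) :
    ENNReal.ofReal (runningMax f n ω) ≤ maximalFunction f ω := by
  have hle (n : ℕ) : ENNReal.ofReal ‖f n ω‖ ≤ maximalFunction f ω := by
    rw [ofReal_norm]
    exact le_iSup (fun j ↦ ‖f j ω‖ₑ) n
  induction n with
  | zero => simpa [runningMax] using hle 0
  | succ n ih =>
    have : runningMax f (n + 1) ω = max (runningMax f n ω) ‖f (n + 1) ω‖ := by
      simp [runningMax, partialSups_add_one]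
    rw [this, ENNReal.ofReal_max]
    exact max_le ih (hle (n + 1))

theorem maximalFunction_eq_iSup (f : ℕ → Ω → X) (ω : Ω) :
    maximalFunction f ω = ⨆ n, ENNReal.ofReal (runningMax f n ω) := by
  refine le_antisymm (iSup_mono fun n ↦ ?_) (iSup_le fun n ↦ ofReal_runningMax_le f n ω)
  rw [← ofReal_norm]
  exact ENNReal.ofReal_le_ofReal (le_partialSups (fun i ↦ ‖f i ω‖) n)

theorem ofReal_partialSquareFunction_le (f : ℕ → Ω → X) (n : ℕ) (ω : Ω) :
    ENNReal.ofReal (partialSquareFunction f n ω) ≤ squareFunction f ω := by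
  have hS : 0 ≤ partialSquareFunction f n ω := Real.sqrt_nonneg _
  unfold squareFunction
  rw [one_div, ENNReal.le_rpow_inv_iff two_pos, ENNReal.ofReal_rpow_of_nonneg hS zero_le_two,
    Real.rpow_two, sq_partialSquareFunction, ENNReal.ofReal_sum_of_nonneg fun _ _ ↦ sq_nonneg _]
  simp only [ENNReal.ofReal_pow (norm_nonneg _), ofReal_norm]
  exact ENNReal.sum_le_tsum _

end Elementary

theorem two_rpow_add_one_le_cosh_mul_exp {p : ℝ} (hp : 1 ≤ p) :
    (2 : ℝ) ^ (p + 1) ≤ Real.cosh (6 * p) * Real.exp (-(3 * p)) := by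
  have h2 : (2 : ℝ) ≤ Real.exp 1 := by linarith [Real.add_one_le_exp (1 : ℝ)]
  have h3 : (2 : ℝ) ^ p ≤ Real.exp p := by
    rw [← mul_one p, ← Real.exp_one_rpow, mul_one]
    exact Real.rpow_le_rpow zero_le_two h2 (by linarith)
  have h4 : (2 : ℝ) ≤ Real.exp p := h2.trans (Real.exp_le_exp.2 hp)
  have h5 : Real.exp (6 * p) / 2 ≤ Real.cosh (6 * p) := by
    rw [Real.cosh_eq]
    linarith [Real.exp_pos (-(6 * p))]
  have h6 : Real.exp (6 * p) * Real.exp (-(3 * p)) = Real.exp p * Real.exp p * Real.exp p := by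
    rw [← Real.exp_add, ← Real.exp_add, ← Real.exp_add]; congr 1; ring
  have h7 : 2 * 2 * (2 : ℝ) ^ p ≤ Real.exp p * Real.exp p * Real.exp p := by gcongr
  calc (2 : ℝ) ^ (p + 1) = 2 * 2 * (2 : ℝ) ^ p / 2 := by
        rw [Real.rpow_add_one two_ne_zero]; ring
    _ ≤ Real.exp (6 * p) / 2 * Real.exp (-(3 * p)) := by
      rw [div_mul_eq_mul_div, h6]; linarith
    _ ≤ _ := by gcongr

section GoodLambda

variable {Ω X : Type*} [NormedAddCommGroup X] [NormedSpace ℝ X] [CompleteSpace X]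
  [MeasurableSpace X] [BorelSpace X] {mΩ : MeasurableSpace Ω}
  {μ : Measure Ω} {ℱ : Filtration ℕ mΩ} {f : ℕ → Ω → X} {D : ℝ}

theorem IsCondSymmetricMartingale.measurable_runningMax (h : IsCondSymmetricMartingale f ℱ μ)
    (n : ℕ) : Measurable[ℱ n] (runningMax f n) := by
  induction n with
  | zero =>
    have : runningMax f 0 = fun ω ↦ ‖f 0 ω‖ := by ext ω; simp [runningMax]
    rw [this]
    exact measurable_norm.comp (h.measurable 0)
  | succ n ih =>
    have : runningMax f (n + 1) = fun ω ↦ max (runningMax f n ω) ‖f (n + 1) ω‖ := by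
      ext ω; simp [runningMax, partialSups_add_one]
    rw [this]
    exact (ih.mono (ℱ.mono n.le_succ) le_rfl).max (measurable_norm.comp (h.measurable (n + 1)))

variable [SecondCountableTopology X]

theorem IsCondSymmetricMartingale.measurable_partialSquareFunction
    (h : IsCondSymmetricMartingale f ℱ μ) (n : ℕ) : Measurable (partialSquareFunction f n) := by
  unfold partialSquareFunction
  refine (Finset.measurable_sum _ fun j _ ↦ ?_).sqrt
  exact (measurable_norm.pow_const 2).comp ((h.measurable_increment j).mono (ℱ.le _) le_rfl)

variable [IsProbabilityMeasure μ]

open Classical in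
theorem IsCondSymmetricMartingale.good_lambda (h : IsCondSymmetricMartingale f ℱ μ)
    (hD : IsTwoSmooth X D) (hD1 : 1 ≤ D) {p : ℝ} (hp : 1 ≤ p) {t : ℝ} (ht : 0 < t) (n : ℕ) :
    ENNReal.ofReal (2 ^ (p + 1)) *
        μ {ω | 2 * t < runningMax f n ω ∧ D * √(24 * p) * partialSquareFunction f n ω ≤ t} ≤
      μ {ω | t < runningMax f n ω} := by
  set a : ℕ → Ω → ℝ := fun j ω ↦
    if t < runningMax f j ω ∧ runningMax f j ω ≤ 2 * t then 1 else 0 with ha_def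
  have ha (j : ℕ) : Measurable[ℱ j] (a j) :=
    Measurable.ite ((measurableSet_lt measurable_const (h.measurable_runningMax j)).inter
      (measurableSet_le (h.measurable_runningMax j) measurable_const))
      measurable_const measurable_const
  set l : ℝ := 12 * p / t with hl
  set Z : Ω → ℝ := fun ω ↦ Real.cosh (l * ‖martingaleTransform a f n ω‖) *
    Real.exp (-(l ^ 2 * D ^ 2 / 2) * transformBracket a f n ω) with hZ
  have hZ1 : ∫⁻ ω, ENNReal.ofReal (Z ω) ∂μ ≤ 1 := h.lintegral_cosh_mul_exp_le_one hD ha l n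
  have hM : Measurable (runningMax f n) := (h.measurable_runningMax n).mono (ℱ.le n) le_rfl
  have hS := h.measurable_partialSquareFunction n
  set B := {ω | 2 * t < runningMax f n ω ∧ D * √(24 * p) * partialSquareFunction f n ω ≤ t}
    with hB
  set C := {ω | t < runningMax f n ω} with hC
  have hBm : MeasurableSet B := (measurableSet_lt measurable_const hM).inter
    (measurableSet_le (hS.const_mul _) measurable_const)
  have hCm : MeasurableSet C := measurableSet_lt measurable_const hM
  have hsqrt : 2 ≤ √(24 * p) := Real.le_sqrt_of_sq_le (by linarith)
  have hZB (ω) (hω : ω ∈ B) : (2 : ℝ) ^ (p + 1) ≤ Z ω := by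
    obtain ⟨hω1, hω2⟩ := hω
    have hS0 : 0 ≤ partialSquareFunction f n ω := Real.sqrt_nonneg _
    have hc : 2 ≤ D * √(24 * p) := by nlinarith
    have hSt : partialSquareFunction f n ω ≤ t / 2 := by nlinarith
    have hG : t / 2 ≤ ‖martingaleTransform a f n ω‖ :=
      half_le_norm_sum_of_two_mul_lt_partialSups (x := fun j ↦ f j ω) (h.zero ω) ht.le
        (fun j hj ↦ (norm_increment_le_partialSquareFunction f hj ω).trans hSt) hω1
    have hQ : transformBracket a f n ω ≤ partialSquareFunction f n ω ^ 2 := by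
      rw [sq_partialSquareFunction]
      refine Finset.sum_le_sum fun j _ ↦ ?_
      simp only [ha_def]
      split_ifs
      · rw [one_smul]
      · simp
    have hQ2 : l ^ 2 * D ^ 2 / 2 * transformBracket a f n ω ≤ 3 * p := by
      have h1 : (D * √(24 * p) * partialSquareFunction f n ω) ^ 2 ≤ t ^ 2 := by gcongr
      rw [mul_pow, mul_pow, Real.sq_sqrt (by linarith)] at h1
      have h2 : D ^ 2 * partialSquareFunction f n ω ^ 2 ≤ t ^ 2 / (24 * p) := by
        rw [le_div_iff₀ (by linarith)]; linarith
      calc l ^ 2 * D ^ 2 / 2 * transformBracket a f n ω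
          ≤ l ^ 2 * D ^ 2 / 2 * partialSquareFunction f n ω ^ 2 := by gcongr
        _ = l ^ 2 / 2 * (D ^ 2 * partialSquareFunction f n ω ^ 2) := by ring
        _ ≤ l ^ 2 / 2 * (t ^ 2 / (24 * p)) := by gcongr
        _ = 3 * p := by rw [hl]; field_simp; norm_num
    refine (two_rpow_add_one_le_cosh_mul_exp hp).trans ?_
    have hl6 : 6 * p ≤ l * ‖martingaleTransform a f n ω‖ := by
      calc 6 * p = l * (t / 2) := by rw [hl]; field_simp; norm_num
        _ ≤ _ := by gcongr
    have hcosh : Real.cosh (6 * p) ≤ Real.cosh (l * ‖martingaleTransform a f n ω‖) := by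
      rw [Real.cosh_le_cosh, abs_of_nonneg (by linarith)]
      exact hl6.trans (le_abs_self _)
    have hexp : Real.exp (-(3 * p)) ≤
        Real.exp (-(l ^ 2 * D ^ 2 / 2) * transformBracket a f n ω) :=
      Real.exp_le_exp.2 (by linarith)
    exact mul_le_mul hcosh hexp (Real.exp_pos _).le (Real.cosh_pos _).le
  have hZC (ω) (hω : ω ∉ C) : Z ω = 1 := by
    have h0 (j) (hj : j ∈ Finset.range n) : a j ω = 0 := by
      refine if_neg fun hj' ↦ hω ?_
      exact hj'.1.trans_le (monotone_runningMax f ω (Finset.mem_range.1 hj).le)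
    have h1 : martingaleTransform a f n ω = 0 :=
      Finset.sum_eq_zero fun j hj ↦ by rw [h0 j hj, zero_smul]
    have h2 : transformBracket a f n ω = 0 :=
      Finset.sum_eq_zero fun j hj ↦ by rw [h0 j hj, zero_smul, norm_zero, zero_pow two_ne_zero]
    simp [hZ, h1, h2]
  have hBC : B ⊆ C := fun ω hω ↦ (by linarith [hω.1] : t < runningMax f n ω)
  have hint : ENNReal.ofReal (2 ^ (p + 1)) * μ B + μ Cᶜ ≤ 1 := by
    refine le_trans ?_ hZ1
    rw [← lintegral_indicator_const hBm, ← lintegral_indicator_one hCm.compl,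
      ← lintegral_add_left (measurable_const.indicator hBm)]
    refine lintegral_mono fun ω ↦ ?_
    by_cases hω : ω ∈ B
    · simpa [hω, hBC hω] using ENNReal.ofReal_le_ofReal (hZB ω hω)
    · by_cases hω' : ω ∈ C
      · simp [hω, hω']
      · simp [hω, hω', hZC ω hω']
  rw [← measure_univ (μ := μ), ← measure_add_measure_compl hCm] at hint
  exact (ENNReal.add_le_add_iff_right (measure_ne_top μ _)).1 hint

theorem IsCondSymmetricMartingale.lintegral_runningMax_rpow_le
    (h : IsCondSymmetricMartingale f ℱ μ) (hD : IsTwoSmooth X D) (hD1 : 1 ≤ D) {p : ℝ}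
    (hp : 1 ≤ p) (n : ℕ) :
    ∫⁻ ω, ENNReal.ofReal (runningMax f n ω ^ p) ∂μ ≤
      ENNReal.ofReal ((20 * √p * D) ^ p) *
        ∫⁻ ω, ENNReal.ofReal (partialSquareFunction f n ω ^ p) ∂μ := by
  have hp0 : 0 < p := one_pos.trans_le hp
  have hM : Measurable (runningMax f n) := (h.measurable_runningMax n).mono (ℱ.le n) le_rfl
  have hS := h.measurable_partialSquareFunction n
  have hM0 := runningMax_nonneg f n
  have hS0 (ω) : 0 ≤ partialSquareFunction f n ω := Real.sqrt_nonneg _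
  set c : ℝ := D * √(24 * p) with hc
  have hc0 : 0 ≤ c := by positivity
  set IM := ∫⁻ ω, ENNReal.ofReal (runningMax f n ω ^ p) ∂μ with hIM
  set IS := ∫⁻ ω, ENNReal.ofReal (partialSquareFunction f n ω ^ p) ∂μ with hIS
  have hD0 : 0 < D := hD.1
  rcases eq_or_ne IS ⊤ with hIS' | hIS'
  · rw [hIS', ENNReal.mul_top (by
      rw [Ne, ENNReal.ofReal_eq_zero, not_le]
      positivity)]
    exact le_top
  have hIMfin : IM ≠ ⊤ := by
    have : IM ≤ ENNReal.ofReal ((n : ℝ) ^ p) * IS := by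
      rw [hIM, hIS, ← lintegral_const_mul' _ _ ENNReal.ofReal_ne_top]
      refine lintegral_mono fun ω ↦ ?_
      rw [← ENNReal.ofReal_mul (by positivity), ← Real.mul_rpow (by positivity) (hS0 ω)]
      exact ENNReal.ofReal_le_ofReal (Real.rpow_le_rpow (hM0 ω)
        (runningMax_le_mul_partialSquareFunction (h.zero ω) n) hp0.le)
    exact ne_top_of_le_ne_top (ENNReal.mul_ne_top ENNReal.ofReal_ne_top hIS') this
  have scale (r : ℝ) (hr : 0 ≤ r) (g : Ω → ℝ) (hg : ∀ ω, 0 ≤ g ω) :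
      ∫⁻ ω, ENNReal.ofReal ((r * g ω) ^ p) ∂μ =
        ENNReal.ofReal (r ^ p) * ∫⁻ ω, ENNReal.ofReal (g ω ^ p) ∂μ := by
    rw [← lintegral_const_mul' _ _ ENNReal.ofReal_ne_top]
    refine lintegral_congr fun ω ↦ ?_
    rw [Real.mul_rpow hr (hg ω), ENNReal.ofReal_mul (by positivity)]
  have hmain : ENNReal.ofReal (2 ^ (p + 1)) *
      ∫⁻ ω, ENNReal.ofReal ((2⁻¹ * runningMax f n ω) ^ p) ∂μ ≤ IM + ENNReal.ofReal (2 ^ (p + 1)) *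
      ∫⁻ ω, ENNReal.ofReal ((c * partialSquareFunction f n ω) ^ p) ∂μ := by
    rw [hIM, lintegral_rpow_eq_lintegral_meas_lt_mul μ (ae_of_all _ fun ω ↦
        mul_nonneg (by norm_num) (hM0 ω)) (hM.const_mul _).aemeasurable hp0,
      lintegral_rpow_eq_lintegral_meas_lt_mul μ (ae_of_all _ hM0) hM.aemeasurable hp0,
      lintegral_rpow_eq_lintegral_meas_lt_mul μ (ae_of_all _ fun ω ↦
        mul_nonneg hc0 (hS0 ω)) (hS.const_mul _).aemeasurable hp0,
      mul_left_comm, mul_left_comm (ENNReal.ofReal (2 ^ (p + 1))), ← mul_add]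
    gcongr
    rw [← lintegral_const_mul' _ _ ENNReal.ofReal_ne_top,
      ← lintegral_const_mul' _ _ ENNReal.ofReal_ne_top]
    have hanti : Antitone fun t ↦ μ {ω | t < runningMax f n ω} := fun s t hst ↦
      measure_mono fun ω hω ↦ hst.trans_lt hω
    have hmeas : Measurable fun t ↦ μ {ω | t < runningMax f n ω} * ENNReal.ofReal (t ^ (p - 1)) :=
      hanti.measurable.mul (measurable_id.pow_const (p - 1)).ennreal_ofReal
    rw [← lintegral_add_left hmeas]
    refine setLIntegral_mono' measurableSet_Ioi fun t ht ↦ ?_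
    rw [← mul_assoc, ← mul_assoc, ← add_mul]
    gcongr
    have hsub : {ω | t < 2⁻¹ * runningMax f n ω} ⊆
        {ω | 2 * t < runningMax f n ω ∧ c * partialSquareFunction f n ω ≤ t} ∪
          {ω | t < c * partialSquareFunction f n ω} := fun ω hω ↦ by
      rcases le_or_gt (c * partialSquareFunction f n ω) t with h1 | h1
      · have hω' : t < 2⁻¹ * runningMax f n ω := hω
        exact Or.inl ⟨by linarith, h1⟩
      · exact Or.inr h1
    calc _ ≤ ENNReal.ofReal (2 ^ (p + 1)) *
          (μ {ω | 2 * t < runningMax f n ω ∧ c * partialSquareFunction f n ω ≤ t} +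
            μ {ω | t < c * partialSquareFunction f n ω}) := by
          gcongr
          exact (measure_mono hsub).trans (measure_union_le _ _)
      _ ≤ _ := by
        rw [mul_add]
        gcongr
        exact h.good_lambda hD hD1 hp ht n
  rw [scale _ (by norm_num) _ hM0, scale _ hc0 _ hS0, ← hIM, ← hIS, ← mul_assoc, ← mul_assoc,
    ← ENNReal.ofReal_mul (by positivity), ← ENNReal.ofReal_mul (by positivity)] at hmain
  have e2 : (2 : ℝ) ^ (p + 1) * 2⁻¹ ^ p = 2 := by
    rw [Real.rpow_add_one two_ne_zero, Real.inv_rpow zero_le_two]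
    field_simp
  rw [e2, ENNReal.ofReal_ofNat, two_mul] at hmain
  have hfin := (ENNReal.add_le_add_iff_left hIMfin).1 hmain
  refine hfin.trans ?_
  gcongr
  have h4 : (2 : ℝ) ^ (p + 1) ≤ 4 ^ p := by
    calc (2 : ℝ) ^ (p + 1) ≤ 2 ^ (2 * p) :=
          Real.rpow_le_rpow_of_exponent_le one_le_two (by linarith)
      _ = 4 ^ p := by rw [Real.rpow_mul zero_le_two]; norm_num
  have h24 : √(24 * p) ≤ 5 * √p := by
    rw [Real.sqrt_mul (by norm_num)]
    gcongr
    rw [Real.sqrt_le_left (by norm_num)]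
    norm_num
  calc (2 : ℝ) ^ (p + 1) * c ^ p ≤ 4 ^ p * c ^ p := by gcongr
    _ = (4 * c) ^ p := (Real.mul_rpow (by norm_num) hc0).symm
    _ ≤ (20 * √p * D) ^ p := by
      refine Real.rpow_le_rpow (by positivity) ?_ hp0.le
      rw [hc]
      nlinarith

theorem IsCondSymmetricMartingale.eLpNorm_maximalFunction_le
    (h : IsCondSymmetricMartingale f ℱ μ) (hD : IsTwoSmooth X D) {p : ℝ} (hp : 1 ≤ p) :
    eLpNorm (maximalFunction f) (ENNReal.ofReal p) μ ≤
      ENNReal.ofReal (20 * √p * D) * eLpNorm (squareFunction f) (ENNReal.ofReal p) μ := by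
  have hp0 : 0 < p := one_pos.trans_le hp
  have hD0 : 0 < D := hD.1
  rcases subsingleton_or_nontrivial X with hX | hX
  · have : maximalFunction f = 0 := by
      ext ω
      simp [maximalFunction, Subsingleton.elim _ (0 : X)]
    simp [this]
  have hM (n : ℕ) : Measurable (runningMax f n) :=
    (h.measurable_runningMax n).mono (ℱ.le n) le_rfl
  have hpne : ENNReal.ofReal p ≠ 0 := by simpa using hp0
  rw [eLpNorm_eq_lintegral_rpow_enorm_toReal hpne ENNReal.ofReal_ne_top,
    eLpNorm_eq_lintegral_rpow_enorm_toReal hpne ENNReal.ofReal_ne_top,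
    ENNReal.toReal_ofReal hp0.le]
  simp only [enorm_eq_self]
  have hle : ∫⁻ ω, maximalFunction f ω ^ p ∂μ ≤
      ENNReal.ofReal (20 * √p * D) ^ p * ∫⁻ ω, squareFunction f ω ^ p ∂μ := by
    have e (ω) : maximalFunction f ω ^ p = ⨆ n, ENNReal.ofReal (runningMax f n ω ^ p) := by
      rw [maximalFunction_eq_iSup, ← ENNReal.orderIsoRpow_apply p hp0, OrderIso.map_iSup]
      simp only [ENNReal.orderIsoRpow_apply]
      exact iSup_congr fun n ↦ ENNReal.ofReal_rpow_of_nonneg (runningMax_nonneg f n ω) hp0.le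
    simp only [e]
    rw [lintegral_iSup (fun n ↦ ((hM n).pow_const p).ennreal_ofReal) fun m n hmn ω ↦
      ENNReal.ofReal_le_ofReal (Real.rpow_le_rpow (runningMax_nonneg f m ω)
        (monotone_runningMax f ω hmn) hp0.le)]
    refine iSup_le fun n ↦ (h.lintegral_runningMax_rpow_le hD hD.one_le hp n).trans ?_
    rw [ENNReal.ofReal_rpow_of_nonneg (by positivity) hp0.le]
    gcongr with ω
    have hS0 : 0 ≤ partialSquareFunction f n ω := Real.sqrt_nonneg _
    rw [← ENNReal.ofReal_rpow_of_nonneg hS0 hp0.le]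
    exact ENNReal.rpow_le_rpow (ofReal_partialSquareFunction_le f n ω) hp0.le
  calc _ ≤ (ENNReal.ofReal (20 * √p * D) ^ p * ∫⁻ ω, squareFunction f ω ^ p ∂μ) ^ (1 / p) :=
        ENNReal.rpow_le_rpow hle (by positivity)
    _ = _ := by
      rw [ENNReal.mul_rpow_of_nonneg _ _ (by positivity), ← ENNReal.rpow_mul,
        mul_one_div_cancel hp0.ne', ENNReal.rpow_one]

end GoodLambda

section Rademacher

/-- The coordinates of the sequence of independent fair signs. -/
def fairSign (i : ℕ) (ω : ℕ → Bool) : ℝ := if ω i then 1 else -1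

/-- The law of one fair coin. -/
noncomputable def fairCoin : Measure Bool :=
  (2⁻¹ : ℝ≥0∞) • Measure.dirac true + (2⁻¹ : ℝ≥0∞) • Measure.dirac false

instance : IsProbabilityMeasure fairCoin := ⟨by simp [fairCoin, ENNReal.inv_two_add_inv_two]⟩

/-- The law of a sequence of independent fair coins. -/
noncomputable def fairCoins : Measure (ℕ → Bool) := Measure.infinitePi fun _ ↦ fairCoin

instance : IsProbabilityMeasure fairCoins := by unfold fairCoins; infer_instance

theorem measurable_fairSign (i : ℕ) : Measurable (fairSign i) :=
  (measurable_of_finite fun b : Bool ↦ if b then (1 : ℝ) else -1).comp (measurable_pi_apply i)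

theorem stronglyMeasurable_fairSign (i : ℕ) : StronglyMeasurable (fairSign i) :=
  (measurable_fairSign i).stronglyMeasurable

theorem abs_fairSign (i : ℕ) (ω : ℕ → Bool) : |fairSign i ω| = 1 := by
  unfold fairSign; split_ifs <;> simp

theorem iIndepFun_fairSign : iIndepFun fairSign fairCoins :=
  iIndepFun_infinitePi (P := fun _ : ℕ ↦ fairCoin)
    (X := fun _ (b : Bool) ↦ if b then (1 : ℝ) else -1) fun _ ↦ measurable_of_finite _

theorem map_fairSign (i : ℕ) : fairCoins.map (fairSign i) =
    (2⁻¹ : ℝ≥0∞) • Measure.dirac 1 + (2⁻¹ : ℝ≥0∞) • Measure.dirac (-1) := by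
  have hs : Measurable fun b : Bool ↦ if b then (1 : ℝ) else -1 := measurable_of_finite _
  have : fairSign i = (fun b : Bool ↦ if b then (1 : ℝ) else -1) ∘ fun ω ↦ ω i := rfl
  rw [this, ← Measure.map_map hs (measurable_pi_apply i), fairCoins, Measure.infinitePi_map_eval,
    fairCoin, Measure.map_add _ _ hs, Measure.map_smul, Measure.map_smul, Measure.map_dirac' hs,
    Measure.map_dirac' hs]
  simp

theorem map_neg_fairSign (i : ℕ) :
    fairCoins.map (fun ω ↦ -fairSign i ω) = fairCoins.map (fairSign i) := by
  have : (fun ω ↦ -fairSign i ω) = Neg.neg ∘ fairSign i := rfl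
  rw [this, ← Measure.map_map measurable_neg (measurable_fairSign i), map_fairSign,
    Measure.map_add _ _ measurable_neg, Measure.map_smul, Measure.map_smul,
    Measure.map_dirac' measurable_neg, Measure.map_dirac' measurable_neg, neg_neg, add_comm]

theorem integral_fairSign (i : ℕ) : ∫ ω, fairSign i ω ∂fairCoins = 0 := by
  have h1 : ∫ ω, fairSign i ω ∂fairCoins = ∫ x, x ∂(fairCoins.map (fairSign i)) :=
    (integral_map (f := fun x : ℝ ↦ x) (measurable_fairSign i).aemeasurable
      measurable_id.aestronglyMeasurable).symm
  have h2 : ∫ ω, -fairSign i ω ∂fairCoins = ∫ x, x ∂(fairCoins.map fun ω ↦ -fairSign i ω) :=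
    (integral_map (f := fun x : ℝ ↦ x) (measurable_fairSign i).neg.aemeasurable
      measurable_id.aestronglyMeasurable).symm
  rw [map_neg_fairSign, ← h1, integral_neg] at h2
  linarith

theorem integrable_fairSign (i : ℕ) : Integrable (fairSign i) fairCoins :=
  .of_bound (measurable_fairSign i).aestronglyMeasurable 1
    (ae_of_all _ fun ω ↦ (abs_fairSign i ω).le)

/-- The random walk with steps `± b` stopped at time `n`. -/
noncomputable def stoppedWalk (b : ℝ) (n j : ℕ) (ω : ℕ → Bool) : ℝ :=
  ∑ i ∈ Finset.range j, if i < n then b * fairSign (i + 1) ω else 0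

variable {b : ℝ} {n : ℕ}

theorem increment_stoppedWalk (j : ℕ) (ω : ℕ → Bool) :
    increment (stoppedWalk b n) j ω = if j < n then b * fairSign (j + 1) ω else 0 := by
  simp [increment, stoppedWalk, Finset.sum_range_succ]

theorem isCondSymmetric_const_mul_fairSign (b : ℝ) {i j : ℕ} (hij : i < j) :
    IsCondSymmetric (Filtration.natural fairSign stronglyMeasurable_fairSign i) fairCoins
      fun ω ↦ b * fairSign j ω := by
  intro B hB
  have hind := iIndepFun_fairSign.indep_comap_natural_of_lt stronglyMeasurable_fairSign hij
  have key {T : Set ℝ} (hT : MeasurableSet T) :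
      fairCoins⟦{ω | fairSign j ω ∈ T} | Filtration.natural fairSign stronglyMeasurable_fairSign i⟧
        =ᵐ[fairCoins] fun _ ↦ (fairCoins.map (fairSign j)).real T := by
    refine (condExp_indep_eq (measurable_fairSign j).comap_le (Filtration.le _ i)
      (stronglyMeasurable_const.indicator ⟨T, hT, rfl⟩) hind).trans (ae_of_all _ fun ω ↦ ?_)
    have hT' := measurable_fairSign j hT
    rw [map_measureReal_apply (measurable_fairSign j) hT]
    exact integral_indicator_one hT'
  have h1 : MeasurableSet {x : ℝ | b * x ∈ B} := measurable_const_mul b hB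
  have h2 : MeasurableSet {x : ℝ | -(b * x) ∈ B} := (measurable_const_mul b).neg hB
  refine (key h1).trans ((key h2).trans ?_).symm
  refine ae_of_all _ fun ω ↦ ?_
  change (fairCoins.map (fairSign j)).real _ = (fairCoins.map (fairSign j)).real _
  rw [← map_neg_fairSign, map_measureReal_apply (f := fun ω ↦ -fairSign j ω)
    (measurable_fairSign j).neg h2, map_neg_fairSign,
    map_measureReal_apply (measurable_fairSign j) h1]
  simp

theorem isCondSymmetric_zero {Ω : Type*} {m mΩ : MeasurableSpace Ω} (μ : Measure Ω) :
    IsCondSymmetric m μ fun _ ↦ (0 : ℝ) := by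
  intro B _
  simp

theorem isCondSymmetricMartingale_stoppedWalk (b : ℝ) (n : ℕ) :
    IsCondSymmetricMartingale (stoppedWalk b n)
      (Filtration.natural fairSign stronglyMeasurable_fairSign) fairCoins where
  martingale := by
    refine martingale_of_condExp_sub_eq_zero_nat (fun j ↦ ?_) (fun j ↦ ?_) fun j ↦ ?_
    · refine Measurable.stronglyMeasurable (Finset.measurable_sum _ fun i hi ↦ ?_)
      have : Measurable[Filtration.natural fairSign stronglyMeasurable_fairSign j]
          (fairSign (i + 1)) :=
        ((Filtration.stronglyAdapted_natural stronglyMeasurable_fairSign (i + 1)).measurable).mono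
          (Filtration.mono _ (Finset.mem_range.1 hi)) le_rfl
      split_ifs
      · exact this.const_mul b
      · exact measurable_const
    · refine integrable_finsetSum _ fun i _ ↦ ?_
      split_ifs
      · exact (integrable_fairSign _).const_mul b
      · exact integrable_zero _ _ _
    · have e : stoppedWalk b n (j + 1) - stoppedWalk b n j =
          (if j < n then b else 0) • fairSign (j + 1) := by
        ext ω
        have := increment_stoppedWalk (b := b) (n := n) j ω
        simp only [increment] at this
        rw [Pi.sub_apply, this]
        split_ifs <;> simp
      rw [e]
      refine (condExp_smul _ _ _).trans ?_
      filter_upwards [iIndepFun_fairSign.condExp_natural_ae_eq_of_lt stronglyMeasurable_fairSign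
        j.lt_succ_self] with ω hω
      rw [Pi.smul_apply, hω, integral_fairSign]
      simp
  zero ω := by simp [stoppedWalk]
  condSymmetric j := by
    have e : increment (stoppedWalk b n) j =
        fun ω ↦ if j < n then b * fairSign (j + 1) ω else 0 :=
      funext (increment_stoppedWalk j)
    rw [e]
    split_ifs
    · exact isCondSymmetric_const_mul_fairSign b j.lt_succ_self
    · exact isCondSymmetric_zero _

theorem squareFunction_stoppedWalk (hb : 0 ≤ b) (n : ℕ) (ω : ℕ → Bool) :
    squareFunction (stoppedWalk b n) ω = ENNReal.ofReal (√n * b) := by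
  have e (j : ℕ) : ‖increment (stoppedWalk b n) j ω‖ₑ ^ 2 =
      if j < n then ENNReal.ofReal (b ^ 2) else 0 := by
    rw [increment_stoppedWalk]
    split_ifs
    · rw [← ofReal_norm, Real.norm_eq_abs, abs_mul, abs_fairSign, abs_of_nonneg hb, mul_one,
        ENNReal.ofReal_pow hb]
    · simp
  unfold squareFunction
  simp only [e]
  rw [tsum_eq_sum (s := Finset.range n) fun j hj ↦ if_neg (by simpa using hj),
    Finset.sum_congr rfl fun j hj ↦ if_pos (Finset.mem_range.1 hj), Finset.sum_const,
    Finset.card_range, nsmul_eq_mul, ← ENNReal.ofReal_natCast,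
    ← ENNReal.ofReal_mul (Nat.cast_nonneg n), ENNReal.ofReal_rpow_of_nonneg (by positivity)
    (by norm_num), ← Real.sqrt_eq_rpow, Real.sqrt_mul (Nat.cast_nonneg n), Real.sqrt_sq hb]

theorem fairCoins_all_heads (n : ℕ) :
    fairCoins {ω | ∀ i ∈ Finset.Icc 1 n, ω i = true} = (2⁻¹ : ℝ≥0∞) ^ n := by
  have e : {ω : ℕ → Bool | ∀ i ∈ Finset.Icc 1 n, ω i = true} =
      (Finset.Icc 1 n : Set ℕ).pi fun _ ↦ {true} := by
    ext ω; simp [Set.mem_pi]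
  have hc : fairCoin {true} = 2⁻¹ := by simp [fairCoin]
  rw [e, fairCoins, Measure.infinitePi_pi _ fun _ _ ↦ measurableSet_singleton _]
  simp [hc]

theorem le_eLpNorm_maximalFunction_stoppedWalk (hb : 0 ≤ b) (n : ℕ) {p : ℝ} (hp : 1 ≤ p) :
    ENNReal.ofReal (n * b) * ((2⁻¹ : ℝ≥0∞) ^ n) ^ (1 / p) ≤
      eLpNorm (maximalFunction (stoppedWalk b n)) (ENNReal.ofReal p) fairCoins := by
  set H := {ω : ℕ → Bool | ∀ i ∈ Finset.Icc 1 n, ω i = true} with hH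
  have hHm : MeasurableSet H := by
    rw [hH]
    measurability
  have hp0 : 0 < p := one_pos.trans_le hp
  have key := eLpNorm_indicator_const (μ := fairCoins) (c := ENNReal.ofReal (n * b)) hHm
    (p := ENNReal.ofReal p) (by simpa using hp0) ENNReal.ofReal_ne_top
  rw [fairCoins_all_heads, enorm_eq_self, ENNReal.toReal_ofReal hp0.le] at key
  rw [← key]
  refine eLpNorm_mono_enorm fun ω ↦ ?_
  simp only [enorm_eq_self]
  refine Set.indicator_le (fun ω hω ↦ ?_) ω
  refine le_trans (le_of_eq ?_) (le_iSup (fun j ↦ ‖stoppedWalk b n j ω‖ₑ) n)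
  have : stoppedWalk b n n ω = n * b := by
    have h1 (i) (hi : i ∈ Finset.range n) :
        (if i < n then b * fairSign (i + 1) ω else 0) = b := by
      have hi' := Finset.mem_range.1 hi
      have : ω (i + 1) = true := hω (i + 1) (Finset.mem_Icc.2 ⟨by omega, hi'⟩)
      simp [hi', fairSign, this]
    rw [stoppedWalk, Finset.sum_congr rfl h1]
    simp
  rw [this, ← ofReal_norm, Real.norm_of_nonneg (by positivity)]

theorem ofReal_le_eLpNorm_maximalFunction_stoppedWalk {p a : ℝ} (hp : 1 ≤ p) (ha : 0 < a) :
    ENNReal.ofReal (1 / 4 * √p * a) ≤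
      eLpNorm (maximalFunction (stoppedWalk (a / √⌈p⌉₊) ⌈p⌉₊)) (ENNReal.ofReal p) fairCoins := by
  have hp0 : 0 < p := one_pos.trans_le hp
  refine le_trans ?_ (le_eLpNorm_maximalFunction_stoppedWalk (by positivity) ⌈p⌉₊ hp)
  set n := ⌈p⌉₊ with hn
  have hpn : p ≤ n := Nat.le_ceil p
  have hnp : (n : ℝ) ≤ 2 * p := by linarith [Nat.ceil_lt_add_one hp0.le]
  have hn0 : (0 : ℝ) < n := hp0.trans_le hpn
  have e : ((2⁻¹ : ℝ≥0∞) ^ n) ^ (1 / p) = ENNReal.ofReal ((2⁻¹ : ℝ) ^ ((n : ℝ) * (1 / p))) := by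
    have : (2⁻¹ : ℝ≥0∞) = ENNReal.ofReal 2⁻¹ := by
      rw [ENNReal.ofReal_inv_of_pos two_pos, ENNReal.ofReal_ofNat]
    rw [← ENNReal.rpow_natCast, ← ENNReal.rpow_mul, this,
      ENNReal.ofReal_rpow_of_nonneg (by norm_num) (by positivity)]
  rw [e, ← ENNReal.ofReal_mul (by positivity)]
  refine ENNReal.ofReal_le_ofReal ?_
  have h1 : (1 / 4 : ℝ) ≤ 2⁻¹ ^ ((n : ℝ) * (1 / p)) := by
    calc (1 / 4 : ℝ) = 2⁻¹ ^ (2 : ℝ) := by norm_num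
      _ ≤ _ := Real.rpow_le_rpow_of_exponent_ge (by norm_num) (by norm_num) (by
        rw [mul_one_div, div_le_iff₀ hp0]; exact hnp)
  have h2 : √p * a ≤ n * (a / √n) := by
    have : n * (a / √n) = √n * a := by
      have hs := Real.mul_self_sqrt hn0.le
      field_simp
      linarith [Real.sq_sqrt hn0.le]
    rw [this]
    gcongr
  calc 1 / 4 * √p * a = (√p * a) * (1 / 4) := by ring
    _ ≤ _ := mul_le_mul h2 h1 (by norm_num) (by positivity)

end Rademacher

/-- Upper bound with an absolute constant `A`, and its optimality up to an absolute constant: the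
bound is attained up to a constant factor `c`, for every exponent `p ≥ 1` and every prescribed
value `a` of `D ‖S₂‖_p`, already for `X = ℝ`, which is `(2, 1)`-smooth. -/
theorem theorem4p3 :
    (∃ A : ℝ, 0 < A ∧
      ∀ (X : Type*) [NormedAddCommGroup X] [NormedSpace ℝ X] [CompleteSpace X]
        [TopologicalSpace.SeparableSpace X] [MeasurableSpace X] [BorelSpace X]
        (D : ℝ), IsTwoSmooth X D →
      ∀ (Ω : Type*) (mΩ : MeasurableSpace Ω) (μ : Measure Ω) [IsProbabilityMeasure μ]
        (ℱ : Filtration ℕ mΩ) (f : ℕ → Ω → X), IsCondSymmetricMartingale f ℱ μ →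
      ∀ p : ℝ, 1 ≤ p →
        eLpNorm (maximalFunction f) (ENNReal.ofReal p) μ ≤
          ENNReal.ofReal (A * √p * D) * eLpNorm (squareFunction f) (ENNReal.ofReal p) μ) ∧
    IsTwoSmooth ℝ 1 ∧
    (∃ c : ℝ, 0 < c ∧ ∀ p : ℝ, 1 ≤ p → ∀ a : ℝ, 0 < a →
      ∃ (Ω : Type) (mΩ : MeasurableSpace Ω) (μ : Measure Ω) (ℱ : Filtration ℕ mΩ)
        (f : ℕ → Ω → ℝ),
        IsProbabilityMeasure μ ∧ IsCondSymmetricMartingale f ℱ μ ∧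
        eLpNorm (squareFunction f) (ENNReal.ofReal p) μ = ENNReal.ofReal a ∧
        ENNReal.ofReal (c * √p * a) ≤ eLpNorm (maximalFunction f) (ENNReal.ofReal p) μ) := by
  refine ⟨⟨20, by norm_num, ?_⟩, isTwoSmooth_real, 1 / 4, by norm_num, fun p hp a ha ↦ ?_⟩
  · intro X _ _ _ _ _ _ D hD Ω mΩ μ _ ℱ f hf p hp
    have := UniformSpace.secondCountable_of_separable X
    exact hf.eLpNorm_maximalFunction_le hD hp
  · have hn : (0 : ℝ) < ⌈p⌉₊ := (one_pos.trans_le hp).trans_le (Nat.le_ceil p)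
    refine ⟨ℕ → Bool, inferInstance, fairCoins, Filtration.natural fairSign
      stronglyMeasurable_fairSign, stoppedWalk (a / √⌈p⌉₊) ⌈p⌉₊, inferInstance,
      isCondSymmetricMartingale_stoppedWalk _ _, ?_,
      ofReal_le_eLpNorm_maximalFunction_stoppedWalk hp ha⟩
    have e : squareFunction (stoppedWalk (a / √⌈p⌉₊) ⌈p⌉₊) = fun _ ↦ ENNReal.ofReal a := by
      ext ω
      rw [squareFunction_stoppedWalk (by positivity), mul_div_cancel₀ _ (by positivity)]
    rw [e, eLpNorm_const _ (by simpa using one_pos.trans_le hp) (IsProbabilityMeasure.ne_zero _)]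
    simp
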